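/- Let $(X,\delta)$ be a metric space. For $\epsilon>0$ let $\mathcal N_\epsilon(X)\in\mathbb N\cup\{\infty\}$ be the least number of open balls of radius $\epsilon$, centred in $X$, that cover $X$. For $\beta>0$ put $\mathrm{ord}_\beta(\epsilon)=\exp(-\epsilon^{-\beta})$ and $$\mathcal H^{\mathrm{ord}_\beta}(X)=\lim_{\epsilon\to0}\ \inf\Big\{\sum_{j\in J}\mathrm{ord}_\beta(r_j)\Big\},$$ the infimum being over the countable coverings of $X$ by balls $B(x_j,r_j)$, $j\in J$, with $x_j\in X$ and $0<r_j\le\epsilon$. The lower box, upper box, Hausdorff and packing orders of $X$ are the following elements of $[0,\infty]$ (with $\sup\emptyset=0$, $\inf\emptyset=\infty$): $$\underline{\mathsf{ord}}_B X=\sup\{\beta>0:\mathcal N_\epsilon(X)\,\mathrm{ord}_\beta(\epsilon)\xrightarrow[\epsilon\to0]{}+\infty\},\qquad \overline{\mathsf{ord}}_B X=\inf\{\beta>0:\mathcal N_\epsilon(X)\,\mathrm{ord}_\beta(\epsilon)\xrightarrow[\epsilon\to0]{}0\},$$ $$\mathsf{ord}_H X=\sup\{\beta>0:\mathcal H^{\mathrm{ord}_\beta}(X)=+\infty\},\qquad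 \mathsf{ord}_P X=\inf\Big\{\sup_{n\ge1}\overline{\mathsf{ord}}_B E_n:\ X=\bigcup_{n\ge1}E_n\Big\},$$ where subsets $E_n\subset X$ carry the induced metric. Theorem. Let $d\ge1$ and $k\ge0$ be integers and $\alpha\in[0,1]$. Let $\mathcal F^{d,k,\alpha}$ be the set of functions $f\in C^k([0,1]^d,[-1,1])$ such that $\|D^jf(x)\|\le1$ for all $0\le j\le k$ and $x\in[0,1]^d$ and, if $\alpha>0$, $\|D^kf(x)-D^kf(y)\|\le\|x-y\|^\alpha$ for all $x,y\in[0,1]^d$, where $\mathbb R^d$ carries the Euclidean norm and $D^jf(x)$ the operator norm of $j$-linear forms. Endow $\mathcal F^{d,k,\alpha}$ with the distance of the sup norm. Then $$\mathsf{ord}_H\mathcal F^{d,k,\alpha}=\mathsf{ord}_P\mathcal F^{d,k,\alpha}=\underline{\mathsf{ord}}_B\mathcal F^{d,k,\alpha}=\overline{\mathsf{ord}}_B\mathcal F^{d,k,\alpha}=\frac d{k+\alpha},$$ where $\frac d{k+\alpha}=+\infty$ if $k=\alpha=0$. -/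

import Mathlib

open Set Filter Topology
open scoped ENNReal

noncomputable section

namespace MetricScale

/-! ### Scales of metric spaces

A growth is a family `scl α : ℝ → ℝ` indexed by `α > 0`, of which only the values on `(0, 1)` with
`α > 0` matter. Scales take their values in `[0, ∞]`, so that `sup ∅ = 0` and `inf ∅ = ∞`. -/

/-- The growth of orders: `ord_α(ε) = exp (-ε ^ (-α))`. -/
def ord (α ε : ℝ) : ℝ := Real.exp (-(ε ^ (-α)))

/-- The covering number: least cardinality of a covering of `X` by open balls of radius `ε`
centred in `X`; it is `⊤` if there is no finite such covering. -/
def coveringNumber (X : Type*) [PseudoMetricSpace X] (ε : ℝ) : ℕ∞ :=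
  ⨅ (C : Set X) (_ : (⋃ x ∈ C, Metric.ball x ε) = univ), C.encard

/-- The lower box scale. -/
def lowerBoxScale (scl : ℝ → ℝ → ℝ) (X : Type*) [PseudoMetricSpace X] : ℝ≥0∞ :=
  ⨆ (α : ℝ) (_ : 0 < α ∧
    Tendsto (fun ε : ℝ => (coveringNumber X ε : ℝ≥0∞) * ENNReal.ofReal (scl α ε))
      (𝓝[>] 0) (𝓝 ⊤)), ENNReal.ofReal α

/-- The upper box scale. -/
def upperBoxScale (scl : ℝ → ℝ → ℝ) (X : Type*) [PseudoMetricSpace X] : ℝ≥0∞ :=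
  ⨅ (α : ℝ) (_ : 0 < α ∧
    Tendsto (fun ε : ℝ => (coveringNumber X ε : ℝ≥0∞) * ENNReal.ofReal (scl α ε))
      (𝓝[>] 0) (𝓝 0)), ENNReal.ofReal α

/-- `H_ε^φ(X)`: infimum of `∑ φ(radius)` over the countable coverings of `X` by balls of radius at
most `ε`. A ball is given by its centre and its radius. -/
def hausdorffPre (φ : ℝ → ℝ) (X : Type*) [PseudoMetricSpace X] (ε : ℝ) : ℝ≥0∞ :=
  ⨅ (J : Set (X × ℝ)) (_ : J.Countable ∧ (∀ b ∈ J, 0 < b.2 ∧ b.2 ≤ ε) ∧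
    (⋃ b ∈ J, Metric.ball b.1 b.2) = univ), ∑' b : J, ENNReal.ofReal (φ b.1.2)

/-- The Hausdorff `φ`-measure of `X`, the limit of `H_ε^φ(X)` as `ε → 0`. As `H_ε^φ(X)` is
nonincreasing in `ε`, the limit is a supremum. -/
def hausdorffMeas (φ : ℝ → ℝ) (X : Type*) [PseudoMetricSpace X] : ℝ≥0∞ :=
  ⨆ ε ∈ Ioo (0 : ℝ) 1, hausdorffPre φ X ε

/-- The Hausdorff scale. -/
def hausdorffScale (scl : ℝ → ℝ → ℝ) (X : Type*) [PseudoMetricSpace X] : ℝ≥0∞ :=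
  ⨆ (α : ℝ) (_ : 0 < α ∧ hausdorffMeas (scl α) X = ⊤), ENNReal.ofReal α

/-- The packing scale: the upper box scale made countably stable. -/
def packingScale (scl : ℝ → ℝ → ℝ) (X : Type*) [PseudoMetricSpace X] : ℝ≥0∞ :=
  ⨅ (E : ℕ → Set X) (_ : (⋃ n, E n) = univ), ⨆ n, upperBoxScale scl (E n)

/-! ### The functional spaces -/

/-- The cube `[0, 1]^d` in Euclidean space. -/
def cube (d : ℕ) : Set (EuclideanSpace ℝ (Fin d)) := {x | ∀ i, x i ∈ Icc (0 : ℝ) 1}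

theorem isCompact_cube (d : ℕ) : IsCompact (cube d) := by
  have h : IsCompact (Set.pi univ fun _ : Fin d => Icc (0 : ℝ) 1) :=
    isCompact_univ_pi fun _ => isCompact_Icc
  have h2 := (EuclideanSpace.equiv (Fin d) ℝ).toHomeomorph.isCompact_preimage.2 h
  convert h2 using 1
  ext x
  exact ⟨fun hx i _ => hx i, fun hx i => hx i (mem_univ i)⟩

instance (d : ℕ) : CompactSpace (cube d) := isCompact_iff_compactSpace.1 (isCompact_cube d)

/-- The space `F^{d,k,α}`, as a subset of the continuous functions on the cube with the sup norm.
Derivatives are taken within the cube, so that they do not depend on the extension `g` of `f`.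
The case `j = 0` of the bound says that `f` takes its values in `[-1, 1]`. -/
def funSpace (d k : ℕ) (α : ℝ) : Set C(cube d, ℝ) :=
  {f | ∃ g : EuclideanSpace ℝ (Fin d) → ℝ,
    (∀ x : cube d, g x = f x) ∧
    ContDiffOn ℝ k g (cube d) ∧
    (∀ j ≤ k, ∀ x ∈ cube d, ‖iteratedFDerivWithin ℝ j g (cube d) x‖ ≤ 1) ∧
    (0 < α → ∀ x ∈ cube d, ∀ y ∈ cube d,
      ‖iteratedFDerivWithin ℝ k g (cube d) x - iteratedFDerivWithin ℝ k g (cube d) y‖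
        ≤ ‖x - y‖ ^ α)}

end MetricScale

end

noncomputable section

namespace MetricScale

/-! ### Comparison of the scales -/

/-! On any space the Hausdorff order is at most the packing order and the lower box order, and both
of these are at most the upper box order. So two estimates suffice: the Hausdorff order is at least
`d / (k + α)` and the upper box order is at most that.

Lower estimate (`hausdorffMeas_ord_funSpace`). If `β * (k + α) < d`, fix `t > k + α` with `β * t <
d` and superpose, over all `n`, bumps of width `b ^ (-n)` and height `c * b ^ (-t * n)`, switched on
or off independently at `b ^ (d * n)` grid points. As `t > k + α`, the derivatives and Hölder
quotients are geometric series, so a small `c` puts every sum in the space. Choices first differing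
at level `n` give functions at distance at least of order `b ^ (-t * n)`, so under the fair coin
measure a ball of that size has mass at most `2 ^ (-b ^ (d * n))`. Since `β * t < d`, this is
negligible against `ord β` of the radius, and the mass distribution principle makes the Hausdorff
measure infinite.

Upper estimate (`coveringNumber_subset_funSpace_le`). By a Taylor type estimate, a function is
determined up to `ε` by its `k`-jets, rounded to precision of order `ε`, on a grid of mesh of order
`ε ^ (1 / (k + α))`. The logarithm of the number of codes is `O(ε ^ (-d / (k + α)) * log (1 / ε))`,
and the logarithmic factor does not affect the order. -/

theorem ord_pos (β ε : ℝ) : 0 < ord β ε := Real.exp_pos _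

theorem ord_le_ord {β γ ε : ℝ} (h : β ≤ γ) (hε : 0 < ε) (hε1 : ε ≤ 1) : ord γ ε ≤ ord β ε :=
  Real.exp_le_exp.2 <| neg_le_neg <|
    Real.rpow_le_rpow_of_exponent_ge hε hε1 (neg_le_neg h)

theorem exists_cover_of_coveringNumber_ne_top {X : Type*} [PseudoMetricSpace X] {ε : ℝ}
    (h : coveringNumber X ε ≠ ⊤) :
    ∃ C : Set X, (⋃ x ∈ C, Metric.ball x ε) = univ ∧ C.encard ≤ coveringNumber X ε := by
  -- An infimum in `ℕ∞` is attained; finiteness is what makes the successor strictly larger.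
  have h1 : coveringNumber X ε < coveringNumber X ε + 1 := (ENat.lt_add_one_iff h).2 le_rfl
  conv_lhs at h1 => rw [coveringNumber]
  simp only [iInf_lt_iff] at h1
  obtain ⟨C, hC, hlt⟩ := h1
  exact ⟨C, hC, (ENat.lt_add_one_iff h).1 hlt⟩

theorem coveringNumber_le {X : Type*} [PseudoMetricSpace X] {ε : ℝ} {C : Set X}
    (h : (⋃ x ∈ C, Metric.ball x ε) = univ) : coveringNumber X ε ≤ C.encard :=
  iInf₂_le C h

theorem tsum_image_radius_le {X Y : Type*} (φ : ℝ → ℝ) (r : ℝ) (f : Y → X) (C : Set Y) :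
    ∑' b : ((fun x => (f x, r)) '' C : Set (X × ℝ)), ENNReal.ofReal (φ b.1.2) ≤
      (C.encard : ℝ≥0∞) * ENNReal.ofReal (φ r) := by
  have h : ∀ b : ((fun x => (f x, r)) '' C : Set (X × ℝ)),
      ENNReal.ofReal (φ b.1.2) = ENNReal.ofReal (φ r) := by
    rintro ⟨_, x, _, rfl⟩
    rfl
  rw [tsum_congr h, ENNReal.tsum_set_const]
  gcongr
  exact encard_image_le _ _

theorem hausdorffPre_le {X : Type*} [PseudoMetricSpace X] {φ : ℝ → ℝ} {ε : ℝ} {J : Set (X × ℝ)}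
    (hJ : J.Countable) (hr : ∀ b ∈ J, 0 < b.2 ∧ b.2 ≤ ε)
    (hc : (⋃ b ∈ J, Metric.ball b.1 b.2) = univ) :
    hausdorffPre φ X ε ≤ ∑' b : J, ENNReal.ofReal (φ b.1.2) :=
  iInf₂_le J ⟨hJ, hr, hc⟩

theorem hausdorffPre_anti (φ : ℝ → ℝ) (X : Type*) [PseudoMetricSpace X] {ε ε' : ℝ} (h : ε ≤ ε') :
    hausdorffPre φ X ε' ≤ hausdorffPre φ X ε :=
  le_iInf₂ fun _ hJ => hausdorffPre_le hJ.1 (fun b hb => ⟨(hJ.2.1 b hb).1, (hJ.2.1 b hb).2.trans h⟩)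
    hJ.2.2

theorem hausdorffPre_le_coveringNumber_mul {φ : ℝ → ℝ} (X : Type*) [PseudoMetricSpace X] {ε : ℝ}
    (hε : 0 < ε) (hφ : 0 < φ ε) :
    hausdorffPre φ X ε ≤ (coveringNumber X ε : ℝ≥0∞) * ENNReal.ofReal (φ ε) := by
  by_cases h : coveringNumber X ε = ⊤
  · rw [h, ENat.toENNReal_top, ENNReal.top_mul (ENNReal.ofReal_pos.2 hφ).ne']
    exact le_top
  obtain ⟨C, hC, hle⟩ := exists_cover_of_coveringNumber_ne_top h
  have hfin : C.Finite := finite_of_encard_le_coe (k := (coveringNumber X ε).toNat) (by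
    rwa [ENat.natCast_toNat h])
  have hcov : (⋃ b ∈ (fun x => (x, ε)) '' C, Metric.ball b.1 b.2) = univ := by
    rwa [biUnion_image]
  calc _ ≤ _ := hausdorffPre_le (hfin.countable.image _)
          (by rintro _ ⟨x, _, rfl⟩; exact ⟨hε, le_rfl⟩) hcov
    _ ≤ _ := tsum_image_radius_le φ ε id C
    _ ≤ _ := by gcongr

/-- Coverings by balls of equal radius are admissible in the Hausdorff infimum, and `hausdorffPre`
only grows as the radius shrinks. -/
theorem hausdorffScale_le_lowerBoxScale (X : Type*) [PseudoMetricSpace X] :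
    hausdorffScale ord X ≤ lowerBoxScale ord X := by
  refine iSup₂_le fun β hβ => le_iSup₂_of_le β ⟨hβ.1, ?_⟩ le_rfl
  rw [ENNReal.tendsto_nhds_top_iff_nnreal]
  intro M
  have hM : (M : ℝ≥0∞) < hausdorffMeas (ord β) X := hβ.2 ▸ ENNReal.coe_lt_top
  simp only [hausdorffMeas, lt_iSup_iff] at hM
  obtain ⟨ε, hε, hlt⟩ := hM
  filter_upwards [Ioc_mem_nhdsGT hε.1] with r hr
  exact hlt.trans_le ((hausdorffPre_anti _ X hr.2).trans
    (hausdorffPre_le_coveringNumber_mul X hr.1 (ord_pos β r)))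

theorem tendsto_coveringNumber_mul_ord_of_le {X : Type*} [PseudoMetricSpace X] {β γ : ℝ}
    (h : β ≤ γ) (ht : Tendsto (fun ε : ℝ => (coveringNumber X ε : ℝ≥0∞) *
      ENNReal.ofReal (ord β ε)) (𝓝[>] 0) (𝓝 0)) :
    Tendsto (fun ε : ℝ => (coveringNumber X ε : ℝ≥0∞) * ENNReal.ofReal (ord γ ε))
      (𝓝[>] 0) (𝓝 0) := by
  refine tendsto_of_tendsto_of_tendsto_of_le_of_le' tendsto_const_nhds ht
    (Eventually.of_forall fun _ => zero_le) ?_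
  filter_upwards [Ioc_mem_nhdsGT one_pos] with ε hε
  gcongr
  exact ord_le_ord h hε.1 hε.2

theorem lowerBoxScale_le_upperBoxScale (X : Type*) [PseudoMetricSpace X] :
    lowerBoxScale ord X ≤ upperBoxScale ord X := by
  refine iSup₂_le fun β hβ => le_iInf₂ fun γ hγ => ENNReal.ofReal_le_ofReal ?_
  by_contra! hlt
  exact ENNReal.top_ne_zero (tendsto_nhds_unique hβ.2
    (tendsto_coveringNumber_mul_ord_of_le hlt.le hγ.2))

theorem packingScale_le_upperBoxScale (X : Type*) [PseudoMetricSpace X] :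
    packingScale ord X ≤ upperBoxScale ord X := by
  refine iInf₂_le_of_le (fun _ => univ) (iUnion_const _) (iSup_le fun _ => ?_)
  have hN : ∀ ε, coveringNumber (univ : Set X) ε ≤ coveringNumber X ε := by
    refine fun ε => le_iInf₂ fun C hC => ?_
    refine (coveringNumber_le (C := (fun x => (⟨x, mem_univ x⟩ : (univ : Set X))) '' C) ?_).trans
      (encard_image_le _ _)
    rw [biUnion_image, eq_univ_iff_forall]
    rintro ⟨y, hy⟩
    have : y ∈ ⋃ x ∈ C, Metric.ball x ε := hC ▸ mem_univ y
    obtain ⟨x, hx, hyx⟩ := mem_iUnion₂.1 this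
    exact mem_iUnion₂.2 ⟨x, hx, hyx⟩
  refine le_iInf₂ fun β hβ => iInf₂_le β ⟨hβ.1, ?_⟩
  refine tendsto_of_tendsto_of_tendsto_of_le_of_le tendsto_const_nhds hβ.2
    (fun _ => zero_le) fun ε => ?_
  dsimp only
  gcongr
  exact hN ε

theorem hausdorffPre_le_of_iUnion {X : Type*} [PseudoMetricSpace X] {E : ℕ → Set X}
    (hE : (⋃ n, E n) = univ) {φ : ℝ → ℝ} {ε : ℝ} (r : ℕ → ℝ) (hr : ∀ n, 0 < r n ∧ r n ≤ ε)
    (hfin : ∀ n, coveringNumber (E n) (r n) ≠ ⊤) :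
    hausdorffPre φ X ε ≤
      ∑' n, (coveringNumber (E n) (r n) : ℝ≥0∞) * ENNReal.ofReal (φ (r n)) := by
  choose C hC hcard using fun n => exists_cover_of_coveringNumber_ne_top (hfin n)
  have hCfin : ∀ n, (C n).Finite := fun n =>
    finite_of_encard_le_coe (k := (coveringNumber (E n) (r n)).toNat) (by
      rw [ENat.natCast_toNat (hfin n)]; exact hcard n)
  set J : ℕ → Set (X × ℝ) := fun n => (fun x : E n => ((x : X), r n)) '' C n with hJ
  calc hausdorffPre φ X ε
      ≤ ∑' b : (⋃ n, J n : Set (X × ℝ)), ENNReal.ofReal (φ b.1.2) := by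
        refine hausdorffPre_le (countable_iUnion fun n => (hCfin n).countable.image _) ?_ ?_
        · intro b hb
          obtain ⟨n, x, _, rfl⟩ := mem_iUnion.1 hb
          exact hr n
        · rw [eq_univ_iff_forall]
          intro y
          obtain ⟨n, hn⟩ := mem_iUnion.1 (hE ▸ mem_univ y : y ∈ ⋃ n, E n)
          have : (⟨y, hn⟩ : E n) ∈ ⋃ x ∈ C n, Metric.ball x (r n) := hC n ▸ mem_univ _
          obtain ⟨x, hx, hyx⟩ := mem_iUnion₂.1 this
          exact mem_iUnion₂.2 ⟨(x, r n), mem_iUnion.2 ⟨n, x, hx, rfl⟩, hyx⟩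
    _ ≤ ∑' n, ∑' b : J n, ENNReal.ofReal (φ b.1.2) :=
        ENNReal.tsum_iUnion_le_tsum (fun b : X × ℝ => ENNReal.ofReal (φ b.2)) J
    _ ≤ _ := by
        refine ENNReal.tsum_le_tsum fun n => (tsum_image_radius_le φ (r n) _ (C n)).trans ?_
        gcongr
        exact hcard n

/-- Each piece may be covered at its own radius, chosen so small that its contribution is below a
prescribed summable weight. The measure at exponent `β` is then at most `1`, not infinite. -/
theorem hausdorffScale_le_packingScale (X : Type*) [PseudoMetricSpace X] :
    hausdorffScale ord X ≤ packingScale ord X := by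
  refine iSup₂_le fun β hβ => le_iInf₂ fun E hE => ?_
  by_contra! hlt
  have ht : ∀ n, Tendsto (fun ε : ℝ => (coveringNumber (E n) ε : ℝ≥0∞) *
      ENNReal.ofReal (ord β ε)) (𝓝[>] 0) (𝓝 0) := by
    intro n
    have h1 : upperBoxScale ord (E n) < ENNReal.ofReal β :=
      (le_iSup (fun n => upperBoxScale ord (E n)) n).trans_lt hlt
    simp only [upperBoxScale, iInf_lt_iff] at h1
    obtain ⟨γ, hγ, hγβ⟩ := h1
    exact tendsto_coveringNumber_mul_ord_of_le
      ((ENNReal.ofReal_lt_ofReal_iff hβ.1).1 hγβ).le hγ.2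
  obtain ⟨δ, hδ, hsum⟩ := ENNReal.exists_pos_sum_of_countable (ε := 1) one_ne_zero ℕ
  refine absurd hβ.2 (ne_top_of_le_ne_top ENNReal.one_ne_top (iSup₂_le fun ε hε => ?_))
  have hex : ∀ n, ∃ r : ℝ, (0 < r ∧ r ≤ ε) ∧
      (coveringNumber (E n) r : ℝ≥0∞) * ENNReal.ofReal (ord β r) < δ n := fun n =>
    ((show ∀ᶠ r : ℝ in 𝓝[>] 0, 0 < r ∧ r ≤ ε from Ioc_mem_nhdsGT hε.1).and
      ((ht n).eventually_lt_const (ENNReal.coe_pos.2 (hδ n)))).exists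
  choose r hr hlt' using hex
  refine ((hausdorffPre_le_of_iUnion hE r hr fun n htop => ?_).trans
    (ENNReal.tsum_le_tsum fun n => (hlt' n).le)).trans hsum.le
  have := hlt' n
  rw [htop, ENat.toENNReal_top, ENNReal.top_mul (ENNReal.ofReal_pos.2 (ord_pos _ _)).ne'] at this
  exact not_top_lt this

/-! ### A mass distribution principle -/

/-- If a product of finite sets embeds in `X` so that the points which first differ at the `n`-th
coordinate are `2 * a n` apart, then the balls of radius at most `a n` have mass at most
`1 / card (Ω n)` for the uniform product measure. -/
theorem le_hausdorffPre_of_separated {X : Type*} [PseudoMetricSpace X] {Ω : ℕ → Type*}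
    [∀ n, Fintype (Ω n)] [∀ n, Nonempty (Ω n)] (Φ : (∀ n, Ω n) → X) {a : ℕ → ℝ} (ha : Antitone a)
    (hsep : ∀ σ τ n, (∀ m < n, σ m = τ m) → σ n ≠ τ n → 2 * a n ≤ dist (Φ σ) (Φ τ))
    {φ : ℝ → ℝ} {K : ℝ≥0∞} {ε : ℝ}
    (hK : ∀ r, 0 < r → r ≤ ε →
      ∃ n, r ≤ a n ∧ K * (Fintype.card (Ω n) : ℝ≥0∞)⁻¹ ≤ ENNReal.ofReal (φ r)) :
    K ≤ hausdorffPre φ X ε := by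
  classical
  let : ∀ n, MeasurableSpace (Ω n) := fun _ => ⊤
  let u : ∀ n, MeasureTheory.Measure (Ω n) := fun n => (PMF.uniformOfFintype (Ω n)).toMeasure
  let μ : MeasureTheory.Measure (∀ n, Ω n) := MeasureTheory.Measure.infinitePi u
  have hcyl : ∀ n (w : Ω n), μ {σ | σ n = w} = (Fintype.card (Ω n) : ℝ≥0∞)⁻¹ := by
    intro n w
    have h1 := (measurePreserving_eval_infinitePi u n).measure_preimage
      (MeasurableSet.nullMeasurableSet (s := {w}) trivial)
    have h2 : u n {w} = (Fintype.card (Ω n) : ℝ≥0∞)⁻¹ := by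
      simp only [u]
      rw [PMF.toMeasure_apply_singleton _ _ MeasurableSpace.measurableSet_top, PMF.uniformOfFintype_apply]
    rw [← h2, ← h1]
    rfl
  refine le_iInf₂ fun J hJ => ?_
  obtain ⟨hJc, hr, hcov⟩ := hJ
  -- No measurability of these preimages is needed: only monotonicity and countable subadditivity of
  -- `μ` are used.
  let A : X × ℝ → Set (∀ n, Ω n) := fun p => {σ | Φ σ ∈ Metric.ball p.1 p.2}
  have hA : ∀ p : J, K * μ (A p) ≤ ENNReal.ofReal (φ p.1.2) := by
    intro p
    obtain ⟨n, hn, hle⟩ := hK p.1.2 (hr p p.2).1 (hr p p.2).2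
    refine le_trans ?_ hle
    gcongr
    rcases (A p).eq_empty_or_nonempty with h | ⟨τ, hτ⟩
    · rw [h, MeasureTheory.measure_empty]
      exact zero_le
    rw [← hcyl n (τ n)]
    refine MeasureTheory.measure_mono fun σ hσ => ?_
    -- Otherwise the first disagreement occurs at some index at most `n`, so the images are at least
    -- `2 * a n` apart, yet both lie in a ball of radius at most `a n`.
    by_contra hne
    have hex : ∃ m, σ m ≠ τ m := ⟨n, hne⟩
    have h1 := hsep σ τ (Nat.find hex) (fun m hm => not_not.1 (Nat.find_min hex hm))
      (Nat.find_spec hex)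
    have h2 : a n ≤ a (Nat.find hex) := ha (Nat.find_min' hex hne)
    have h3 : dist (Φ σ) (Φ τ) < p.1.2 + p.1.2 :=
      (dist_triangle_right _ _ p.1.1).trans_lt (add_lt_add hσ hτ)
    linarith
  have hun : (univ : Set (∀ n, Ω n)) ⊆ ⋃ p ∈ J, A p := by
    intro σ _
    have : Φ σ ∈ ⋃ b ∈ J, Metric.ball b.1 b.2 := hcov ▸ mem_univ _
    obtain ⟨p, hp, hσ⟩ := mem_iUnion₂.1 this
    exact mem_iUnion₂.2 ⟨p, hp, hσ⟩
  calc K = K * μ univ := by rw [MeasureTheory.measure_univ, mul_one]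
    _ ≤ K * ∑' p : J, μ (A p) := by
        gcongr
        exact (MeasureTheory.measure_mono hun).trans (MeasureTheory.measure_biUnion_le μ hJc A)
    _ = ∑' p : J, K * μ (A p) := ENNReal.tsum_mul_left.symm
    _ ≤ _ := ENNReal.tsum_le_tsum hA

theorem tendsto_mul_pow_sub_mul_pow {p D x y : ℝ} (hp : 0 < p) (hx : 0 < x) (hxy : x < y)
    (hy : 1 < y) : Tendsto (fun n : ℕ => p * y ^ n - D * x ^ n) atTop atTop := by
  have h1 : Tendsto (fun n : ℕ => p - D * (x / y) ^ n) atTop (𝓝 (p - D * 0)) :=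
    tendsto_const_nhds.sub ((tendsto_pow_atTop_nhds_zero_of_lt_one (by positivity)
      ((div_lt_one (by linarith)).2 hxy)).const_mul D)
  rw [mul_zero, sub_zero] at h1
  refine ((tendsto_pow_atTop_atTop_of_one_lt hy).atTop_mul_pos hp h1).congr fun n => ?_
  have : y ^ n ≠ 0 := by positivity
  rw [div_pow]
  field_simp

/-- The cylinders of the product of the sets with `2 ^ (b ^ n) ^ d` elements, at the scales
`c * b ^ (-t * n)`, have mass much smaller than `ord β` of their size if `β * t < d`. -/
theorem exists_forall_scale_le_ord {b d : ℕ} (hb : 2 ≤ b) (hd : 0 < d) {t β c : ℝ} (ht : 0 < t)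
    (hβ : 0 < β) (hβt : β * t < d) (hc : 0 < c) (K : ℝ) (hK : 0 < K) :
    ∃ ε ∈ Ioo (0 : ℝ) 1, ∀ r, 0 < r → r ≤ ε → ∃ n : ℕ, r ≤ c * ((b : ℝ) ^ (-t)) ^ n ∧
      K * ((2 : ℝ) ^ (b ^ n) ^ d)⁻¹ ≤ ord β r := by
  have hb1 : (1 : ℝ) < b := by exact_mod_cast hb
  have hb0 : (0 : ℝ) < b := by linarith
  set θ : ℝ := (b : ℝ) ^ (-t) with hθ
  have hθ0 : 0 < θ := Real.rpow_pos_of_pos hb0 _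
  have hθ1 : θ < 1 := Real.rpow_lt_one_of_one_lt_of_neg hb1 (by linarith)
  set x : ℝ := θ ^ (-β) with hx
  have hx0 : 0 < x := Real.rpow_pos_of_pos hθ0 _
  have hxy : x < (b : ℝ) ^ d := by
    rw [hx, hθ, ← Real.rpow_mul hb0.le, ← Real.rpow_natCast]
    exact Real.rpow_lt_rpow_of_exponent_lt hb1 (by linarith)
  have hy : 1 < (b : ℝ) ^ d := one_lt_pow₀ hb1 hd.ne'
  -- The extra factor `x` in `D` pays for bounding `r` below by the scale `n + 1` rather than `n`.
  have htend := tendsto_mul_pow_sub_mul_pow (D := c ^ (-β) * x) (Real.log_pos one_lt_two) hx0 hxy hy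
  obtain ⟨n₀, hn₀⟩ := (htend.eventually_ge_atTop (Real.log K)).exists_forall_of_atTop
  -- `1 / 2` keeps the threshold below `1`; the other term forces the scale `n` of `r` to be at
  -- least `n₀`.
  refine ⟨min (1 / 2) (c * θ ^ n₀), ⟨by positivity, (min_le_left _ _).trans_lt (by norm_num)⟩, ?_⟩
  intro r hr0 hr
  have hrc : r / c ≤ θ ^ n₀ := by
    rw [div_le_iff₀ hc, mul_comm]
    exact hr.trans (min_le_right _ _)
  obtain ⟨n, hn1, hn2⟩ := exists_nat_pow_near_of_lt_one (div_pos hr0 hc)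
    (hrc.trans (pow_le_one₀ hθ0.le hθ1.le)) hθ0 hθ1
  rw [lt_div_iff₀ hc, mul_comm] at hn1
  rw [div_le_iff₀ hc, mul_comm] at hn2
  refine ⟨n, hn2, ?_⟩
  have hnn : n₀ ≤ n := by
    have : θ ^ (n + 1) < θ ^ n₀ := by
      have := hn1.trans_le (hr.trans (min_le_right _ _))
      exact lt_of_mul_lt_mul_left this hc.le
    have := (pow_lt_pow_iff_right_of_lt_one₀ hθ0 hθ1).1 this
    omega
  have hrβ : r ^ (-β) ≤ c ^ (-β) * x * x ^ n := by
    calc r ^ (-β) ≤ (c * θ ^ (n + 1)) ^ (-β) :=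
          Real.rpow_le_rpow_of_nonpos (by positivity) hn1.le (by linarith)
      _ = c ^ (-β) * x * x ^ n := by
          rw [Real.mul_rpow hc.le (by positivity), hx, ← Real.rpow_natCast, ← Real.rpow_mul hθ0.le,
            mul_comm ((n + 1 : ℕ) : ℝ), Real.rpow_mul hθ0.le, Real.rpow_natCast, pow_succ]
          ring
  have hlog := hn₀ n hnn
  rw [ord, ← Real.log_le_log_iff (by positivity) (Real.exp_pos _), Real.log_exp,
    Real.log_mul hK.ne' (by positivity), Real.log_inv, Real.log_pow]
  push_cast
  have : ((b : ℝ) ^ d) ^ n = ((b : ℝ) ^ n) ^ d := by rw [← pow_mul, ← pow_mul, mul_comm]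
  rw [this] at hlog
  linarith

/-! ### The cube -/

theorem convex_cube (d : ℕ) : Convex ℝ (cube d) := by
  intro x hx y hy a b ha hb hab i
  exact convex_Icc (0 : ℝ) 1 (hx i) (hy i) ha hb hab

theorem uniqueDiffOn_cube (d : ℕ) : UniqueDiffOn ℝ (cube d) := by
  refine uniqueDiffOn_convex (convex_cube d) ⟨WithLp.toLp 2 fun _ => 1 / 2, ?_⟩
  have hopen : IsOpen {x : EuclideanSpace ℝ (Fin d) | ∀ i, x i ∈ Ioo (0 : ℝ) 1} := by
    simp only [ofPred_forall]
    exact isOpen_iInter_of_finite fun i =>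
      isOpen_Ioo.preimage (EuclideanSpace.proj (𝕜 := ℝ) i).continuous
  refine interior_maximal (fun x hx => ?_) hopen ?_
  · exact fun i => Ioo_subset_Icc_self (mem_ofPred.1 hx i)
  · exact mem_ofPred.2 fun i => by norm_num

/-! ### Superposition of bumps centred at the points of a grid -/

/-- A bump function with value `1` at `0`, supported in the closed ball of radius `1 / 3`. -/
def gridBump (d : ℕ) : ContDiffBump (0 : EuclideanSpace ℝ (Fin d)) :=
  ⟨1 / 4, 1 / 3, by norm_num, by norm_num⟩

/-- The integer point with coordinates `q`. -/
def gridPoint {d N : ℕ} (q : Fin d → Fin N) : EuclideanSpace ℝ (Fin d) :=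
  WithLp.toLp 2 fun i => ((q i : ℕ) : ℝ)

/-- The sum of the bumps of size `1 / N` centred at the points `q / N` such that `w q` holds. -/
def bumpSum {d N : ℕ} (w : (Fin d → Fin N) → Bool) (x : EuclideanSpace ℝ (Fin d)) : ℝ :=
  ∑ q, (if w q then (1 : ℝ) else 0) * gridBump d ((N : ℝ) • x - gridPoint q)

/-- The supports have radius `1 / 3 < 1 / 2`, while distinct integer points differ by at least `1`
in some coordinate. Disjointness keeps all later bounds independent of the number of bumps. -/
theorem gridPoint_unique {d N : ℕ} {q q' : Fin d → Fin N} {y : EuclideanSpace ℝ (Fin d)}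
    (h : y - gridPoint q ∈ tsupport (gridBump d)) (h' : y - gridPoint q' ∈ tsupport (gridBump d)) :
    q = q' := by
  rw [ContDiffBump.tsupport_eq, mem_closedBall_zero_iff] at h h'
  funext i
  have h1 := (PiLp.norm_apply_le _ i).trans h
  have h2 := (PiLp.norm_apply_le _ i).trans h'
  simp only [gridPoint, PiLp.sub_apply, gridBump, Real.norm_eq_abs, abs_le] at h1 h2
  have h3 : ((q i : ℕ) : ℝ) < (q' i : ℕ) + 1 := by linarith
  have h4 : ((q' i : ℕ) : ℝ) < (q i : ℕ) + 1 := by linarith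
  norm_cast at h3 h4
  exact Fin.ext (by omega)

theorem sum_le_of_ne_zero_unique {ι : Type*} [Fintype ι] {f : ι → ℝ} {C : ℝ} (hC : 0 ≤ C)
    (hf : ∀ i, f i ≤ C) (hu : ∀ i j, f i ≠ 0 → f j ≠ 0 → i = j) : ∑ i, f i ≤ C := by
  by_cases h : ∃ i, f i ≠ 0
  · obtain ⟨i, hi⟩ := h
    rw [Fintype.sum_eq_single i fun j hj => not_not.1 fun hne => hj (hu j i hne hi)]
    exact hf i
  · push Not at h
    simpa [h] using hC

theorem bumpSum_mem_Icc {d N : ℕ} (w : (Fin d → Fin N) → Bool) (x : EuclideanSpace ℝ (Fin d)) :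
    bumpSum w x ∈ Icc (0 : ℝ) 1 := by
  have h01 : ∀ q, (if w q then (1 : ℝ) else 0) ∈ Icc (0 : ℝ) 1 := by
    intro q
    split_ifs <;> simp
  refine ⟨Finset.sum_nonneg fun q _ => mul_nonneg (h01 q).1 (gridBump d).nonneg,
    sum_le_of_ne_zero_unique zero_le_one
      (fun q => mul_le_one₀ (h01 q).2 (gridBump d).nonneg (gridBump d).le_one) fun q q' hq hq' => ?_⟩
  exact gridPoint_unique (subset_tsupport _ (right_ne_zero_of_mul hq))
    (subset_tsupport _ (right_ne_zero_of_mul hq'))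

theorem bumpSum_gridPoint {d N : ℕ} (hN : 0 < N) (w : (Fin d → Fin N) → Bool) (q : Fin d → Fin N) :
    bumpSum w ((N : ℝ)⁻¹ • gridPoint q) = if w q then 1 else 0 := by
  have hN' : (N : ℝ) ≠ 0 := by positivity
  have h0 : (gridBump d) 0 = 1 :=
    (gridBump d).one_of_mem_closedBall (Metric.mem_closedBall_self (gridBump d).rIn_pos.le)
  rw [bumpSum, smul_inv_smul₀ hN', Fintype.sum_eq_single q, sub_self, h0, mul_one]
  intro q' hq'
  refine mul_eq_zero_of_right _ (not_not.1 fun hne => hq' ?_)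
  refine gridPoint_unique (subset_tsupport _ hne) (y := gridPoint q) ?_
  rw [sub_self]
  exact subset_tsupport _ (by rw [Function.mem_support, h0]; exact one_ne_zero)

/-- The range of `M` covers both uses: bump centres indexed by `Fin N` and nets indexed by `Fin (N +
1)`. -/
theorem inv_smul_gridPoint_mem_cube {d M N : ℕ} (hM : M ≤ N + 1) (q : Fin d → Fin M) :
    (N : ℝ)⁻¹ • gridPoint q ∈ cube d := by
  intro i
  have h : ((q i : ℕ) : ℝ) ≤ N := by
    exact_mod_cast Nat.le_of_lt_succ ((q i).2.trans_le hM)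
  simp only [gridPoint, PiLp.smul_apply, smul_eq_mul]
  exact ⟨by positivity, inv_mul_le_one_of_le₀ h (by positivity)⟩

theorem contDiff_bumpSum {d N : ℕ} (w : (Fin d → Fin N) → Bool) (n : ℕ∞) :
    ContDiff ℝ n (bumpSum w) := by
  refine ContDiff.sum fun q _ => contDiff_const.mul ((gridBump d).contDiff.comp ?_)
  exact (contDiff_id.const_smul _).sub contDiff_const

theorem exists_norm_iteratedFDeriv_gridBump_le (d k : ℕ) :
    ∃ C : ℝ, 1 ≤ C ∧ ∀ j ≤ k, ∀ x, ‖iteratedFDeriv ℝ j (gridBump d) x‖ ≤ C := by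
  have h : ∀ j : ℕ, ∃ C, ∀ x, ‖iteratedFDeriv ℝ j (gridBump d) x‖ ≤ C := fun j =>
    (((gridBump d).contDiff (n := j)).continuous_iteratedFDeriv le_rfl)
      |>.bounded_above_of_compact_support ((gridBump d).hasCompactSupport.iteratedFDeriv j)
  choose C hC using h
  refine ⟨1 + ∑ j ∈ Finset.range (k + 1), |C j|, ?_, fun j hj x => ?_⟩
  · linarith [Finset.sum_nonneg fun j (_ : j ∈ Finset.range (k + 1)) => abs_nonneg (C j)]
  · have := Finset.single_le_sum (fun j _ => abs_nonneg (C j))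
      (Finset.mem_range.2 (Nat.lt_succ_of_le hj))
    linarith [hC j x, le_abs_self (C j)]

theorem iteratedFDeriv_comp_smul_sub {E F : Type*} [NormedAddCommGroup E] [NormedSpace ℝ E]
    [NormedAddCommGroup F] [NormedSpace ℝ F] {f : E → F} {j : ℕ} (hf : ContDiff ℝ j f)
    (r : ℝ) (v x : E) :
    iteratedFDeriv ℝ j (fun y => f (r • y - v)) x =
      (iteratedFDeriv ℝ j f (r • x - v)).compContinuousLinearMap
        fun _ => r • ContinuousLinearMap.id ℝ E := by
  have h := (r • ContinuousLinearMap.id ℝ E).iteratedFDeriv_comp_right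
    (f := fun y => f (y - v)) (n := j) (hf.comp (contDiff_id.sub contDiff_const)) x le_rfl
  rw [iteratedFDeriv_comp_sub] at h
  exact h

theorem norm_iteratedFDeriv_bumpSum_le {d N j : ℕ} {C : ℝ}
    (hC : ∀ x, ‖iteratedFDeriv ℝ j (gridBump d) x‖ ≤ C) (w : (Fin d → Fin N) → Bool)
    (x : EuclideanSpace ℝ (Fin d)) :
    ‖iteratedFDeriv ℝ j (bumpSum w) x‖ ≤ C * (N : ℝ) ^ j := by
  have hC0 : 0 ≤ C := (norm_nonneg _).trans (hC 0)
  have hcd : ∀ q : Fin d → Fin N,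
      ContDiff ℝ j fun y => gridBump d ((N : ℝ) • y - gridPoint q) := fun q =>
    (gridBump d).contDiff.comp ((contDiff_id.const_smul _).sub contDiff_const)
  have hterm : ∀ q, iteratedFDeriv ℝ j
      (fun y => (if w q then (1 : ℝ) else 0) * gridBump d ((N : ℝ) • y - gridPoint q)) x =
      (if w q then (1 : ℝ) else 0) •
        (iteratedFDeriv ℝ j (gridBump d) ((N : ℝ) • x - gridPoint q)).compContinuousLinearMap
          fun _ => (N : ℝ) • ContinuousLinearMap.id ℝ (EuclideanSpace ℝ (Fin d)) := by
    intro q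
    rw [← iteratedFDeriv_comp_smul_sub (gridBump d).contDiff]
    exact iteratedFDeriv_const_smul_apply (a := if w q then (1 : ℝ) else 0) (hcd q).contDiffAt
  have hsum : iteratedFDeriv ℝ j (bumpSum w) x = ∑ q, iteratedFDeriv ℝ j
      (fun y => (if w q then (1 : ℝ) else 0) * gridBump d ((N : ℝ) • y - gridPoint q)) x :=
    iteratedFDeriv_fun_sum_apply fun q _ => (contDiff_const.mul (hcd q)).contDiffAt
  rw [hsum]
  refine (norm_sum_le _ _).trans (sum_le_of_ne_zero_unique (by positivity) (fun q => ?_) ?_)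
  · rw [hterm, norm_smul]
    have h1 : ‖(if w q then (1 : ℝ) else 0)‖ ≤ 1 := by split_ifs <;> simp
    have h2 := (iteratedFDeriv ℝ j (gridBump d) ((N : ℝ) • x - gridPoint q)
      ).norm_compContinuousLinearMap_le
        fun _ => (N : ℝ) • ContinuousLinearMap.id ℝ (EuclideanSpace ℝ (Fin d))
    have h3 : ‖(N : ℝ) • ContinuousLinearMap.id ℝ (EuclideanSpace ℝ (Fin d))‖ ≤ N := by
      rw [norm_smul, Real.norm_natCast]
      exact mul_le_of_le_one_right (by positivity) ContinuousLinearMap.norm_id_le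
    rw [Finset.prod_const, Finset.card_univ, Fintype.card_fin] at h2
    refine (mul_le_of_le_one_left (norm_nonneg _) h1).trans (h2.trans ?_)
    gcongr
    exact hC _
  · have key : ∀ q, ‖iteratedFDeriv ℝ j (fun y => (if w q then (1 : ℝ) else 0) *
        gridBump d ((N : ℝ) • y - gridPoint q)) x‖ ≠ 0 →
        (N : ℝ) • x - gridPoint q ∈ tsupport (gridBump d) := by
      intro q hq
      refine support_iteratedFDeriv_subset (𝕜 := ℝ) j fun h0 => hq ?_
      have h1 : ContinuousMultilinearMap.compContinuousLinearMap
          (0 : ContinuousMultilinearMap ℝ (fun _ : Fin j => EuclideanSpace ℝ (Fin d)) ℝ)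
          (fun _ => (N : ℝ) • ContinuousLinearMap.id ℝ (EuclideanSpace ℝ (Fin d))) = 0 := by
        ext
        rfl
      rw [hterm, h0, h1, smul_zero, norm_zero]
    exact fun q q' hq hq' => gridPoint_unique (key q hq) (key q' hq')

/-- Interpolation at the distance `1 / N`: farther apart, the sup bound on the `k`-th derivative
suffices; closer, the mean value inequality applies, and `u ≤ u ^ α` for `u = N * ‖x - y‖ ≤ 1`. -/
theorem norm_iteratedFDeriv_bumpSum_sub_le {d N k : ℕ} (hN : 0 < N) {C α : ℝ}
    (hα : α ∈ Icc (0 : ℝ) 1) (hC : ∀ j ≤ k + 1, ∀ x, ‖iteratedFDeriv ℝ j (gridBump d) x‖ ≤ C)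
    (w : (Fin d → Fin N) → Bool) (x y : EuclideanSpace ℝ (Fin d)) :
    ‖iteratedFDeriv ℝ k (bumpSum w) x - iteratedFDeriv ℝ k (bumpSum w) y‖ ≤
      2 * C * (N : ℝ) ^ (k + α) * ‖x - y‖ ^ α := by
  have hC0 : 0 ≤ C := (norm_nonneg _).trans (hC 0 (by omega) 0)
  have hN' : (0 : ℝ) < N := by exact_mod_cast hN
  have hsplit : 2 * C * (N : ℝ) ^ (k + α) * ‖x - y‖ ^ α =
      2 * (C * (N : ℝ) ^ k) * (N * ‖x - y‖) ^ α := by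
    rw [Real.rpow_add hN', Real.rpow_natCast, Real.mul_rpow hN'.le (norm_nonneg _)]
    ring
  rw [hsplit]
  rcases le_total 1 (N * ‖x - y‖) with h | h
  · have h1 := norm_iteratedFDeriv_bumpSum_le (hC k (by omega)) w x
    have h2 := norm_iteratedFDeriv_bumpSum_le (hC k (by omega)) w y
    have h3 : 2 * (C * (N : ℝ) ^ k) * 1 ≤ 2 * (C * (N : ℝ) ^ k) * (N * ‖x - y‖) ^ α := by
      gcongr
      exact Real.one_le_rpow h hα.1
    linarith [norm_sub_le (iteratedFDeriv ℝ k (bumpSum w) x) (iteratedFDeriv ℝ k (bumpSum w) y)]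
  · have h1 := convex_univ.norm_image_sub_le_of_norm_fderiv_le
      (f := iteratedFDeriv ℝ k (bumpSum w)) (C := C * (N : ℝ) ^ (k + 1))
      (fun z _ => ((contDiff_bumpSum w ((k + 1 : ℕ) : ℕ∞)).differentiable_iteratedFDeriv
        (by exact_mod_cast Nat.lt_succ_self k)) z)
      (fun z _ => by
        rw [norm_fderiv_iteratedFDeriv]
        exact norm_iteratedFDeriv_bumpSum_le (hC (k + 1) le_rfl) w z)
      (mem_univ y) (mem_univ x)
    have h2 : N * ‖x - y‖ ≤ (N * ‖x - y‖) ^ α := by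
      have := Real.rpow_le_rpow_of_exponent_ge_of_imp (by positivity) h hα.2
        (fun _ h0 => absurd h0 one_ne_zero)
      simpa using this
    have h3 : C * (N : ℝ) ^ k * (N * ‖x - y‖) ≤ C * (N : ℝ) ^ k * (N * ‖x - y‖) ^ α := by gcongr
    have h4 : 0 ≤ C * (N : ℝ) ^ k * (N * ‖x - y‖) ^ α := by positivity
    calc _ ≤ _ := h1
      _ = C * (N : ℝ) ^ k * (N * ‖x - y‖) := by ring
      _ ≤ _ := by linarith

/-! ### Lower bound of the Hausdorff order -/

/-- A superposition over `n` of bumps of size `b ^ (-n)` and height `c * θ ^ n`. -/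
def bumpSeries {d b : ℕ} (c θ : ℝ) (σ : ∀ n : ℕ, (Fin d → Fin (b ^ n)) → Bool)
    (x : EuclideanSpace ℝ (Fin d)) : ℝ :=
  ∑' n, c * θ ^ n * bumpSum (σ n) x

section

variable {d b k : ℕ} {c θ C α : ℝ}

theorem iteratedFDeriv_const_mul_bumpSum {N j : ℕ} (a : ℝ) (w : (Fin d → Fin N) → Bool)
    (x : EuclideanSpace ℝ (Fin d)) :
    iteratedFDeriv ℝ j (fun y => a * bumpSum w y) x = a • iteratedFDeriv ℝ j (bumpSum w) x :=
  iteratedFDeriv_const_smul_apply (a := a) (contDiff_bumpSum w j).contDiffAt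

theorem pow_mul_rpow_eq (hb : 0 < b) (s : ℝ) (n : ℕ) :
    θ ^ n * ((b ^ n : ℕ) : ℝ) ^ s = (θ * (b : ℝ) ^ s) ^ n := by
  have hb' : (0 : ℝ) ≤ b := by positivity
  rw [mul_pow, Nat.cast_pow, ← Real.rpow_natCast (b : ℝ) n, ← Real.rpow_mul hb', mul_comm (n : ℝ),
    Real.rpow_mul hb', Real.rpow_natCast]

theorem norm_iteratedFDeriv_term_le (hb : 0 < b) (hc : 0 ≤ c) (hθ : 0 ≤ θ)
    (hα : α ∈ Icc (0 : ℝ) 1) (hC : ∀ j ≤ k + 1, ∀ x, ‖iteratedFDeriv ℝ j (gridBump d) x‖ ≤ C)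
    (σ : ∀ n : ℕ, (Fin d → Fin (b ^ n)) → Bool) {j : ℕ} (hj : j ≤ k) (n : ℕ)
    (x : EuclideanSpace ℝ (Fin d)) :
    ‖iteratedFDeriv ℝ j (fun y => c * θ ^ n * bumpSum (σ n) y) x‖ ≤
      c * C * (θ * (b : ℝ) ^ (k + α)) ^ n := by
  have hC0 : 0 ≤ C := (norm_nonneg _).trans (hC 0 (by omega) 0)
  have hb1 : (1 : ℝ) ≤ (b ^ n : ℕ) := by exact_mod_cast Nat.one_le_pow n b hb
  rw [iteratedFDeriv_const_mul_bumpSum, norm_smul, Real.norm_of_nonneg (by positivity),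
    ← pow_mul_rpow_eq hb]
  have h1 := norm_iteratedFDeriv_bumpSum_le (hC j (by omega)) (σ n) x
  have h2 : ((b ^ n : ℕ) : ℝ) ^ j ≤ ((b ^ n : ℕ) : ℝ) ^ (k + α) := by
    rw [← Real.rpow_natCast]
    refine Real.rpow_le_rpow_of_exponent_le hb1 ?_
    have : (j : ℝ) ≤ k := by exact_mod_cast hj
    linarith [hα.1]
  calc _ ≤ c * θ ^ n * (C * ((b ^ n : ℕ) : ℝ) ^ (k + α)) := by
        gcongr
        exact h1.trans (by gcongr)
    _ = _ := by ring

/-- Termwise bounds are geometric of ratio `θ * b ^ (k + α)`. The condition `hcC` makes their sum at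
most `1 / 2`, which absorbs the factor `2` of the Hölder estimate. -/
theorem bumpSeries_mem (hb : 0 < b) (hc : 0 ≤ c) (hθ : 0 ≤ θ)
    (hα : α ∈ Icc (0 : ℝ) 1) (hC : ∀ j ≤ k + 1, ∀ x, ‖iteratedFDeriv ℝ j (gridBump d) x‖ ≤ C)
    (hρ : θ * (b : ℝ) ^ (k + α) < 1) (hcC : 2 * (c * C) ≤ 1 - θ * (b : ℝ) ^ (k + α))
    (σ : ∀ n : ℕ, (Fin d → Fin (b ^ n)) → Bool) :
    ContDiff ℝ k (bumpSeries c θ σ) ∧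
    (∀ j ≤ k, ∀ x, ‖iteratedFDeriv ℝ j (bumpSeries c θ σ) x‖ ≤ 1) ∧
    ∀ x y, ‖iteratedFDeriv ℝ k (bumpSeries c θ σ) x - iteratedFDeriv ℝ k (bumpSeries c θ σ) y‖
      ≤ ‖x - y‖ ^ α := by
  have hC0 : 0 ≤ C := (norm_nonneg _).trans (hC 0 (by omega) 0)
  set ρ : ℝ := θ * (b : ℝ) ^ (k + α) with hρdef
  have hρ0 : 0 ≤ ρ := by positivity
  have hgeo : HasSum (fun n : ℕ => c * C * ρ ^ n) (c * C * (1 - ρ)⁻¹) :=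
    (hasSum_geometric_of_lt_one hρ0 hρ).mul_left _
  have hhalf : c * C * (1 - ρ)⁻¹ ≤ 1 / 2 := by
    rw [← div_eq_mul_inv, div_le_iff₀ (by linarith)]
    linarith
  have hcd : ∀ n, ContDiff ℝ ((k : ℕ∞) : WithTop ℕ∞) fun y => c * θ ^ n * bumpSum (σ n) y :=
    fun n => contDiff_const.mul (contDiff_bumpSum (σ n) k)
  have hv : ∀ j : ℕ, (j : ℕ∞) ≤ (k : ℕ∞) → Summable fun n : ℕ => c * C * ρ ^ n :=
    fun _ _ => hgeo.summable
  have hbd : ∀ (j n : ℕ) (x : EuclideanSpace ℝ (Fin d)), (j : ℕ∞) ≤ (k : ℕ∞) →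
      ‖iteratedFDeriv ℝ j (fun y => c * θ ^ n * bumpSum (σ n) y) x‖ ≤ c * C * ρ ^ n :=
    fun j n x hj => norm_iteratedFDeriv_term_le hb hc hθ hα hC σ (by exact_mod_cast hj) n x
  have hder : ∀ j ≤ k, ∀ x, iteratedFDeriv ℝ j (bumpSeries c θ σ) x =
      ∑' n, iteratedFDeriv ℝ j (fun y => c * θ ^ n * bumpSum (σ n) y) x := fun j hj x =>
    iteratedFDeriv_tsum_apply hcd hv hbd (by exact_mod_cast hj) x
  refine ⟨contDiff_tsum hcd hv hbd, fun j hj x => ?_, fun x y => ?_⟩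
  · rw [hder j hj]
    have := tsum_of_norm_bounded hgeo fun n => hbd j n x (by exact_mod_cast hj)
    linarith
  · have hs : ∀ x, Summable fun n =>
        iteratedFDeriv ℝ k (fun y => c * θ ^ n * bumpSum (σ n) y) x := fun x =>
      hgeo.summable.of_norm_bounded fun n => hbd k n x le_rfl
    rw [hder k le_rfl, hder k le_rfl, ← (hs x).tsum_sub (hs y)]
    have hle := tsum_of_norm_bounded (hgeo.mul_left (2 * ‖x - y‖ ^ α))
      (f := fun n => iteratedFDeriv ℝ k (fun y => c * θ ^ n * bumpSum (σ n) y) x -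
        iteratedFDeriv ℝ k (fun y => c * θ ^ n * bumpSum (σ n) y) y) fun n => by
        rw [iteratedFDeriv_const_mul_bumpSum, iteratedFDeriv_const_mul_bumpSum, ← smul_sub,
          norm_smul, Real.norm_of_nonneg (by positivity), hρdef, ← pow_mul_rpow_eq hb]
        calc _ ≤ c * θ ^ n * (2 * C * ((b ^ n : ℕ) : ℝ) ^ (k + α) * ‖x - y‖ ^ α) := by
              gcongr
              exact norm_iteratedFDeriv_bumpSum_sub_le (Nat.pow_pos hb) hα hC (σ n) x y
          _ = _ := by ring
    refine hle.trans ?_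
    have h0 : 0 ≤ 2 * ‖x - y‖ ^ α := by positivity
    nlinarith [mul_le_mul_of_nonneg_left hhalf h0]

/-- At the centre of a level `n` bump where the choices differ, lower levels cancel and level `n`
contributes exactly `c * θ ^ n`; since `θ ≤ 1 / 3`, the tail is at most half of that. -/
theorem exists_le_abs_bumpSeries_sub (hb : 0 < b) (hc : 0 ≤ c) (hθ : 0 ≤ θ) (hθ3 : θ ≤ 1 / 3)
    {σ τ : ∀ n : ℕ, (Fin d → Fin (b ^ n)) → Bool} {n : ℕ} (hlt : ∀ m < n, σ m = τ m)
    (hne : σ n ≠ τ n) :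
    ∃ x ∈ cube d, c * θ ^ n / 2 ≤ |bumpSeries c θ σ x - bumpSeries c θ τ x| := by
  obtain ⟨q, hq⟩ := Function.ne_iff.1 hne
  set x := ((b ^ n : ℕ) : ℝ)⁻¹ • gridPoint q with hx
  refine ⟨x, inv_smul_gridPoint_mem_cube (Nat.le_succ _) q, ?_⟩
  have hgeo : HasSum (fun m : ℕ => c * θ ^ m) (c * (1 - θ)⁻¹) :=
    (hasSum_geometric_of_lt_one hθ (by linarith)).mul_left _
  have hs : ∀ υ : ∀ n : ℕ, (Fin d → Fin (b ^ n)) → Bool,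
      Summable fun m => c * θ ^ m * bumpSum (υ m) x := fun υ =>
    hgeo.summable.of_norm_bounded fun m => by
      have h := bumpSum_mem_Icc (υ m) x
      rw [Real.norm_of_nonneg (mul_nonneg (by positivity) h.1)]
      exact mul_le_of_le_one_right (by positivity) h.2
  set f : ℕ → ℝ := fun m => c * θ ^ m * bumpSum (σ m) x - c * θ ^ m * bumpSum (τ m) x with hf
  have hfs : Summable f := (hs σ).sub (hs τ)
  have hsum : bumpSeries c θ σ x - bumpSeries c θ τ x = ∑' m, f m :=
    ((hs σ).tsum_sub (hs τ)).symm
  have hfn : |f n| = c * θ ^ n := by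
    have h1 : |bumpSum (σ n) x - bumpSum (τ n) x| = 1 := by
      rw [hx, bumpSum_gridPoint (Nat.pow_pos hb), bumpSum_gridPoint (Nat.pow_pos hb)]
      cases h : σ n q <;> cases h' : τ n q <;> simp_all
    simp only [hf]
    rw [← mul_sub, abs_mul, h1, mul_one, abs_of_nonneg (by positivity)]
  have hhead : ∑ m ∈ Finset.range (n + 1), f m = f n := by
    rw [Finset.sum_range_succ, Finset.sum_eq_zero, zero_add]
    intro m hm
    simp only [hf, hlt m (Finset.mem_range.1 hm), sub_self]
  have htail : ‖∑' m, f (m + (n + 1))‖ ≤ c * θ ^ (n + 1) * (1 - θ)⁻¹ := by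
    refine tsum_of_norm_bounded (g := fun m => c * θ ^ (n + 1) * θ ^ m)
      ((hasSum_geometric_of_lt_one hθ (by linarith)).mul_left _) fun m => ?_
    have h1 := bumpSum_mem_Icc (σ (m + (n + 1))) x
    have h2 := bumpSum_mem_Icc (τ (m + (n + 1))) x
    simp only [hf]
    rw [← mul_sub, norm_mul, Real.norm_of_nonneg (by positivity),
      show c * θ ^ (n + 1) * θ ^ m = c * θ ^ (m + (n + 1)) by ring]
    refine mul_le_of_le_one_right (by positivity) ?_
    rw [Real.norm_eq_abs, abs_le]
    constructor <;> linarith [h1.1, h1.2, h2.1, h2.2]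
  have htail' : c * θ ^ (n + 1) * (1 - θ)⁻¹ ≤ c * θ ^ n / 2 := by
    rw [← div_eq_mul_inv, div_le_iff₀ (by linarith), pow_succ]
    have h0 : 0 ≤ c * θ ^ n := by positivity
    nlinarith
  rw [hsum, ← hfs.sum_add_tsum_nat_add (n + 1), hhead]
  have := abs_sub_abs_le_abs_add (f n) (∑' m, f (m + (n + 1)))
  rw [Real.norm_eq_abs] at htail
  linarith

end

theorem hausdorffMeas_ord_funSpace {d k : ℕ} (hd : 0 < d) {α β : ℝ} (hα : α ∈ Icc (0 : ℝ) 1)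
    (hβ : 0 < β) (hβd : β * (k + α) < d) :
    hausdorffMeas (ord β) (funSpace d k α) = ⊤ := by
  obtain ⟨t, hst, htβ⟩ : ∃ t : ℝ, k + α < t ∧ β * t < d := by
    obtain ⟨t, h1, h2⟩ := exists_between ((lt_div_iff₀' hβ).2 hβd)
    exact ⟨t, h1, (lt_div_iff₀' hβ).1 h2⟩
  have ht : 0 < t := lt_of_le_of_lt (add_nonneg (Nat.cast_nonneg k) hα.1) hst
  obtain ⟨b, hb2, hbt⟩ : ∃ b : ℕ, 2 ≤ b ∧ (3 : ℝ) ≤ (b : ℝ) ^ t :=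
    ((eventually_ge_atTop 2).and (((tendsto_rpow_atTop ht).comp
      tendsto_natCast_atTop_atTop).eventually_ge_atTop 3)).exists
  have hb0 : 0 < b := by omega
  have hbR : (1 : ℝ) < b := by exact_mod_cast hb2
  have hbR0 : (0 : ℝ) < b := by linarith
  set θ : ℝ := (b : ℝ) ^ (-t) with hθ
  have hθ0 : 0 < θ := Real.rpow_pos_of_pos hbR0 _
  have hθ3 : θ ≤ 1 / 3 := by
    rw [hθ, Real.rpow_neg hbR0.le, one_div]
    exact inv_anti₀ (by norm_num) hbt
  have hρ : θ * (b : ℝ) ^ (k + α) < 1 := by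
    rw [hθ, ← Real.rpow_add hbR0]
    exact Real.rpow_lt_one_of_one_lt_of_neg hbR (by linarith)
  obtain ⟨C, hC1, hC⟩ := exists_norm_iteratedFDeriv_gridBump_le d (k + 1)
  set c : ℝ := (1 - θ * (b : ℝ) ^ (k + α)) / (2 * C) with hc
  have hc0 : 0 < c := div_pos (by linarith) (by linarith)
  have hcC : 2 * (c * C) ≤ 1 - θ * (b : ℝ) ^ (k + α) := by
    rw [hc]
    field_simp
    exact le_rfl
  have hmem := bumpSeries_mem hb0 hc0.le hθ0.le hα hC hρ hcC
  let Φ : (∀ n : ℕ, (Fin d → Fin (b ^ n)) → Bool) → funSpace d k α := fun σ =>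
    ⟨⟨fun x => bumpSeries c θ σ x, (hmem σ).1.continuous.comp continuous_subtype_val⟩,
      bumpSeries c θ σ, fun _ => rfl, (hmem σ).1.contDiffOn, fun j hj x hx => by
        rw [iteratedFDerivWithin_eq_iteratedFDeriv (uniqueDiffOn_cube d)
          ((hmem σ).1.contDiffAt.of_le (by exact_mod_cast hj)) hx]
        exact (hmem σ).2.1 j hj x, fun _ x hx y hy => by
        rw [iteratedFDerivWithin_eq_iteratedFDeriv (uniqueDiffOn_cube d) (hmem σ).1.contDiffAt hx,
          iteratedFDerivWithin_eq_iteratedFDeriv (uniqueDiffOn_cube d) (hmem σ).1.contDiffAt hy]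
        exact (hmem σ).2.2 x y⟩
  refine ENNReal.eq_top_of_forall_nnreal_le fun K => ?_
  -- `c / 4` because twice the scale must not exceed the gap `c * θ ^ n / 2`; `K + 1` because the
  -- constant must be positive.
  obtain ⟨ε, hε, hscale⟩ := exists_forall_scale_le_ord hb2 hd ht hβ htβ (c := c / 4)
    (by positivity) (K + 1) (by positivity)
  refine le_iSup₂_of_le ε hε (le_hausdorffPre_of_separated Φ (a := fun n => c / 4 * θ ^ n)
    ?_ ?_ ?_)
  · intro m n hmn
    have := pow_le_pow_of_le_one hθ0.le (by linarith) hmn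
    dsimp only
    gcongr
  · intro σ τ n hlt hne
    obtain ⟨x, hx, hle⟩ := exists_le_abs_bumpSeries_sub hb0 hc0.le hθ0.le hθ3 hlt hne
    have h1 := ContinuousMap.dist_apply_le_dist (f := (Φ σ).1) (g := (Φ τ).1) ⟨x, hx⟩
    have h2 : dist ((Φ σ).1 ⟨x, hx⟩) ((Φ τ).1 ⟨x, hx⟩) =
      |bumpSeries c θ σ x - bumpSeries c θ τ x| := rfl
    rw [h2] at h1
    rw [Subtype.dist_eq]
    linarith
  · intro r hr hrε
    obtain ⟨n, hn, hle⟩ := hscale r hr hrε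
    refine ⟨n, hn, ?_⟩
    have hcard : (Fintype.card ((Fin d → Fin (b ^ n)) → Bool) : ℝ≥0∞) =
        ENNReal.ofReal ((2 : ℝ) ^ (b ^ n) ^ d) := by
      rw [Fintype.card_fun, Fintype.card_fun, Fintype.card_bool, Fintype.card_fin, Fintype.card_fin,
        ← ENNReal.ofReal_natCast]
      push_cast
      rfl
    have hK : (K : ℝ≥0∞) ≤ ENNReal.ofReal (K + 1) := by
      rw [← ENNReal.ofReal_coe_nnreal]
      exact ENNReal.ofReal_le_ofReal (by linarith)
    rw [hcard, ← ENNReal.ofReal_inv_of_pos (by positivity)]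
    refine (mul_le_mul_left hK _).trans ?_
    rw [← ENNReal.ofReal_mul (by positivity)]
    exact ENNReal.ofReal_le_ofReal hle

/-- Approximating from below by finite `β` also handles the infinite value when `k = α = 0`. -/
theorem le_hausdorffScale_funSpace {d k : ℕ} (hd : 0 < d) {α : ℝ} (hα : α ∈ Icc (0 : ℝ) 1) :
    (d : ℝ≥0∞) / ((k : ℝ≥0∞) + ENNReal.ofReal α) ≤ hausdorffScale ord (funSpace d k α) := by
  refine ENNReal.le_of_forall_nnreal_lt fun β hβ => ?_
  rcases eq_or_ne β 0 with rfl | hβ0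
  · exact zero_le
  have h1 : (β : ℝ≥0∞) * ((k : ℝ≥0∞) + ENNReal.ofReal α) < d :=
    (ENNReal.lt_div_iff_mul_lt (Or.inr ENNReal.coe_ne_top)
      (Or.inl (ENNReal.add_ne_top.2 ⟨ENNReal.natCast_ne_top k, ENNReal.ofReal_ne_top⟩))).1 hβ
  have h2 : (β : ℝ) * (k + α) < d := by
    have h3 : ENNReal.ofReal (β * (k + α)) < ENNReal.ofReal d := by
      rwa [ENNReal.ofReal_mul β.coe_nonneg, ENNReal.ofReal_add (by positivity) hα.1,
        ENNReal.ofReal_natCast, ENNReal.ofReal_natCast, ENNReal.ofReal_coe_nnreal]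
    exact (ENNReal.ofReal_lt_ofReal_iff (by exact_mod_cast hd)).1 h3
  have hβpos : (0 : ℝ) < β := by exact_mod_cast pos_iff_ne_zero.2 hβ0
  rw [← ENNReal.ofReal_coe_nnreal]
  exact le_iSup₂_of_le (β : ℝ) ⟨hβpos, hausdorffMeas_ord_funSpace hd hα hβpos h2⟩ le_rfl

/-! ### Upper bound of the upper box order -/

/-- A function whose jet at `p` is small and whose highest derivative is Hölder continuous is small
near `p`, along with its derivatives. -/
theorem norm_iteratedFDerivWithin_le_of_jet_le {d k : ℕ} {h : EuclideanSpace ℝ (Fin d) → ℝ}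
    {α H η δ : ℝ} {p : EuclideanSpace ℝ (Fin d)} (hα : 0 ≤ α) (hH : 0 ≤ H)
    (hcd : ContDiffOn ℝ k h (cube d))
    (hhol : ∀ x ∈ cube d, ∀ y ∈ cube d, ‖iteratedFDerivWithin ℝ k h (cube d) x -
      iteratedFDerivWithin ℝ k h (cube d) y‖ ≤ H * ‖x - y‖ ^ α)
    (hp : p ∈ cube d) (hη : 0 ≤ η) (hjet : ∀ j ≤ k, ‖iteratedFDerivWithin ℝ j h (cube d) p‖ ≤ η)
    (hδ : 0 < δ) (hδ1 : δ ≤ 1) (i : ℕ) :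
    ∀ j, j + i = k → ∀ x ∈ cube d, ‖x - p‖ ≤ δ →
      ‖iteratedFDerivWithin ℝ j h (cube d) x‖ ≤ (i + 1) * η + H * δ ^ (i + α) := by
  induction i with
  | zero =>
    rintro j hj x hx hxp
    obtain rfl : j = k := by omega
    have h1 := hhol x hx p hp
    have h2 : ‖x - p‖ ^ α ≤ δ ^ α := Real.rpow_le_rpow (norm_nonneg _) hxp hα
    have h3 := norm_le_norm_add_norm_sub' (iteratedFDerivWithin ℝ j h (cube d) x)
      (iteratedFDerivWithin ℝ j h (cube d) p)
    have h4 := mul_le_mul_of_nonneg_left h2 hH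
    have h5 := hjet j le_rfl
    simp only [Nat.cast_zero, zero_add, one_mul]
    linarith
  | succ i ih =>
    rintro j hj x hx hxp
    have hdiff : DifferentiableOn ℝ (iteratedFDerivWithin ℝ j h (cube d)) (cube d) :=
      hcd.differentiableOn_iteratedFDerivWithin (by exact_mod_cast (by omega : j < k))
        (uniqueDiffOn_cube d)
    -- Descending one order of derivative: integrating from `p` gains a factor `δ`, kept on the
    -- Hölder term and dropped on the jet term, where one more `η` enters.
    have hmv := Convex.norm_image_sub_le_of_norm_hasFDerivWithin_le
      (f := iteratedFDerivWithin ℝ j h (cube d)) (C := (i + 1) * η + H * δ ^ (i + α))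
      (s := cube d ∩ Metric.closedBall p δ) (x := p) (y := x)
      (f' := fderivWithin ℝ (iteratedFDerivWithin ℝ j h (cube d)) (cube d))
      (fun z hz => ((hdiff z hz.1).hasFDerivWithinAt).mono inter_subset_left)
      (fun z hz => by
        rw [norm_fderivWithin_iteratedFDerivWithin]
        exact ih (j + 1) (by omega) z hz.1 (mem_closedBall_iff_norm.1 hz.2))
      ((convex_cube d).inter (convex_closedBall p δ)) ⟨hp, Metric.mem_closedBall_self hδ.le⟩
      ⟨hx, mem_closedBall_iff_norm.2 hxp⟩
    have h3 := norm_le_norm_add_norm_sub' (iteratedFDerivWithin ℝ j h (cube d) x)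
      (iteratedFDerivWithin ℝ j h (cube d) p)
    have h4 := hjet j (by omega)
    have h5 : ((i + 1) * η + H * δ ^ (i + α)) * ‖x - p‖ ≤
        ((i + 1) * η + H * δ ^ (i + α)) * δ := by gcongr
    have h6 : δ ^ (((i + 1 : ℕ) : ℝ) + α) = δ ^ (i + α) * δ := by
      rw [← Real.rpow_add_one hδ.ne']
      congr 1
      push_cast
      ring
    have h7 : (i + 1) * η * δ ≤ (i + 1) * η := mul_le_of_le_one_right (by positivity) hδ1
    rw [h6]
    push_cast
    linarith

theorem norm_le_of_coordinates_le {d j : ℕ}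
    (T : ContinuousMultilinearMap ℝ (fun _ : Fin j => EuclideanSpace ℝ (Fin d)) ℝ) {η : ℝ}
    (hη : 0 ≤ η) (hT : ∀ r : Fin j → Fin d, |T fun i => EuclideanSpace.single (r i) 1| ≤ η) :
    ‖T‖ ≤ (d : ℝ) ^ j * η := by
  refine T.opNorm_le_bound (by positivity) fun m => ?_
  have hm : m = fun i => ∑ l, m i l • EuclideanSpace.single l (1 : ℝ) := by
    funext i
    ext l
    simp [Finset.sum_apply, Pi.single_apply]
  have hle : ∀ r : Fin j → Fin d,
      ‖T fun i => m i (r i) • EuclideanSpace.single (r i) (1 : ℝ)‖ ≤ η * ∏ i, ‖m i‖ := by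
    intro r
    rw [T.map_smul_univ, norm_smul, norm_prod, mul_comm]
    gcongr with i
    · exact hT r
    · exact PiLp.norm_apply_le (m i) (r i)
  calc ‖T m‖ = ‖∑ r : Fin j → Fin d, T fun i => m i (r i) • EuclideanSpace.single (r i) (1 : ℝ)‖ := by
        conv_lhs => rw [hm]
        rw [T.map_sum]
    _ ≤ ∑ r : Fin j → Fin d, η * ∏ i, ‖m i‖ := norm_sum_le_of_le _ fun r _ => hle r
    _ = _ := by
        rw [Finset.sum_const, Finset.card_univ, Fintype.card_fun, Fintype.card_fin, Fintype.card_fin,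
          nsmul_eq_mul]
        push_cast
        ring

/-- Coordinates are rounded down; the value `N` occurs when a coordinate is `1`, hence `Fin (N +
1)`. The bound uses `√d ≤ d`. -/
theorem exists_norm_sub_gridPoint_le {d N : ℕ} (hN : 0 < N) {x : EuclideanSpace ℝ (Fin d)}
    (hx : x ∈ cube d) :
    ∃ q : Fin d → Fin (N + 1), ‖x - (N : ℝ)⁻¹ • gridPoint q‖ ≤ d / N := by
  have hN' : (0 : ℝ) < N := by exact_mod_cast hN
  have hfl : ∀ i, ⌊N * x i⌋₊ < N + 1 := fun i => Nat.lt_succ_of_le <|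
    Nat.floor_le_of_le (mul_le_of_le_one_right hN'.le (hx i).2)
  refine ⟨fun i => ⟨⌊N * x i⌋₊, hfl i⟩, ?_⟩
  have hi : ∀ i, ‖(x - (N : ℝ)⁻¹ • gridPoint (fun i => (⟨⌊N * x i⌋₊, hfl i⟩ : Fin (N + 1)))) i‖
      ≤ 1 / N := by
    intro i
    simp only [gridPoint, PiLp.sub_apply, PiLp.smul_apply, smul_eq_mul, Real.norm_eq_abs]
    have h1 := Nat.floor_le (mul_nonneg hN'.le (hx i).1)
    have h2 := Nat.lt_floor_add_one (N * x i)
    have h3 : x i - (N : ℝ)⁻¹ * ⌊N * x i⌋₊ = (N * x i - ⌊N * x i⌋₊) / N := by field_simp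
    rw [h3, abs_div, abs_of_pos hN', abs_of_nonneg (by linarith)]
    gcongr
    linarith
  rw [EuclideanSpace.norm_eq]
  refine Real.sqrt_le_iff.2 ⟨by positivity, ?_⟩
  calc _ ≤ ∑ _i : Fin d, (1 / (N : ℝ)) ^ 2 := Finset.sum_le_sum fun i _ => by
        gcongr
        exact hi i
    _ = d / (N : ℝ) ^ 2 := by
        rw [Finset.sum_const, Finset.card_univ, Fintype.card_fin, nsmul_eq_mul]
        field_simp
    _ ≤ _ := by
        rw [div_pow]
        gcongr
        have : d ≤ d ^ 2 := Nat.le_self_pow two_ne_zero d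
        exact_mod_cast this

/-- One representative per nonempty fibre of `R` serves as a centre, so the centres lie in `X`
itself. -/
theorem coveringNumber_le_card {X ι : Type*} [PseudoMetricSpace X] [Fintype ι] {ε : ℝ} (R : X → ι)
    (hR : ∀ x y, R x = R y → dist x y < ε) : coveringNumber X ε ≤ Fintype.card ι := by
  let s : range R → X := fun i => i.2.choose
  have hs : ∀ i, R (s i) = i := fun i => i.2.choose_spec
  refine (coveringNumber_le (C := range s) ?_).trans ?_
  · rw [eq_univ_iff_forall]
    intro x
    exact mem_iUnion₂.2 ⟨s ⟨R x, x, rfl⟩, mem_range_self _, hR _ _ (hs ⟨R x, x, rfl⟩).symm⟩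
  · rw [← image_univ]
    refine (encard_image_le _ _).trans ?_
    rw [encard_univ, ENat.card_eq_coe_natCard, ← Nat.card_eq_fintype_card]
    exact_mod_cast Finite.card_subtype_le _

/-- The code of a function is its list of rounded jet coordinates at the grid points. An arbitrary
subset `S` is allowed since covering numbers with centres in the space are not monotone under
inclusion. -/
theorem coveringNumber_subset_funSpace_le {d k : ℕ} (hd : 0 < d) {α : ℝ} (hα : 0 < α)
    {S : Set C(cube d, ℝ)} (hS : S ⊆ funSpace d k α) {M N : ℕ} (hM : 0 < M) (hN : d ≤ N) {ε : ℝ}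
    (hε : (k + 1) * ((d : ℝ) ^ k / M) + 2 * ((d : ℝ) / N) ^ (k + α) < ε) :
    coveringNumber S ε ≤
      (((2 * M + 1) ^ ((N + 1) ^ d * Fintype.card (Σ j : Fin (k + 1), Fin j → Fin d)) : ℕ) : ℕ∞) := by
  have hd1 : (1 : ℝ) ≤ d := by exact_mod_cast hd
  have hM' : (0 : ℝ) < M := by exact_mod_cast hM
  have hN' : (0 : ℝ) < N := by exact_mod_cast hd.trans_le hN
  choose g hg hgcd hgle hghol using fun f : S => hS f.2
  let coord : S → (Fin d → Fin (N + 1)) → (Σ j : Fin (k + 1), Fin j → Fin d) → ℝ := fun f q r =>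
    iteratedFDerivWithin ℝ r.1 (g f) (cube d) ((N : ℝ)⁻¹ • gridPoint q)
      fun i => EuclideanSpace.single (r.2 i) 1
  have hcoord : ∀ f q r, |coord f q r| ≤ 1 := by
    intro f q r
    refine ((iteratedFDerivWithin ℝ r.1 (g f) (cube d) ((N : ℝ)⁻¹ • gridPoint q)).le_opNorm
      fun i => EuclideanSpace.single (r.2 i) 1).trans ?_
    simp only [PiLp.norm_single, norm_one, Finset.prod_const_one, mul_one]
    exact hgle f r.1 (Nat.le_of_lt_succ r.1.2) _ (inv_smul_gridPoint_mem_cube le_rfl q)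
  have hfloor : ∀ f q r, ⌊M * coord f q r⌋ ∈ Finset.Icc (-(M : ℤ)) M := by
    intro f q r
    have h := abs_le.1 (hcoord f q r)
    rw [Finset.mem_Icc, Int.le_floor, ← Int.lt_add_one_iff, Int.floor_lt]
    push_cast
    constructor <;> nlinarith [h.1, h.2]
  let R : S → ((Fin d → Fin (N + 1)) × (Σ j : Fin (k + 1), Fin j → Fin d) →
      Finset.Icc (-(M : ℤ)) M) := fun f qr => ⟨⌊M * coord f qr.1 qr.2⌋, hfloor f qr.1 qr.2⟩
  refine (coveringNumber_le_card R fun f f' hff' => ?_).trans_eq ?_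
  · refine lt_of_le_of_lt ?_ hε
    rw [Subtype.dist_eq, ContinuousMap.dist_le (by positivity)]
    rintro ⟨x, hx⟩
    obtain ⟨q, hq⟩ := exists_norm_sub_gridPoint_le (hd.trans_le hN) hx
    have hp := inv_smul_gridPoint_mem_cube (N := N) le_rfl q
    set p := (N : ℝ)⁻¹ • gridPoint q with hpdef
    have hsub : ∀ j ≤ k, ∀ z ∈ cube d, iteratedFDerivWithin ℝ j (g f - g f') (cube d) z =
        iteratedFDerivWithin ℝ j (g f) (cube d) z - iteratedFDerivWithin ℝ j (g f') (cube d) z :=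
      fun j hj z hz => iteratedFDerivWithin_sub_apply
        ((hgcd f z hz).of_le (by exact_mod_cast hj)) ((hgcd f' z hz).of_le (by exact_mod_cast hj))
        (uniqueDiffOn_cube d) hz
    have hjet : ∀ j ≤ k, ‖iteratedFDerivWithin ℝ j (g f - g f') (cube d) p‖ ≤ (d : ℝ) ^ k / M := by
      intro j hj
      have h1 : ‖iteratedFDerivWithin ℝ j (g f - g f') (cube d) p‖ ≤ (d : ℝ) ^ j * (1 / M) := by
        refine norm_le_of_coordinates_le _ (by positivity) fun r => ?_
        have h2 : ⌊M * coord f q ⟨⟨j, by omega⟩, r⟩⌋ = ⌊M * coord f' q ⟨⟨j, by omega⟩, r⟩⌋ :=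
          congrArg Subtype.val (congrFun hff' (q, ⟨⟨j, by omega⟩, r⟩))
        have h3 := Int.abs_sub_lt_one_of_floor_eq_floor h2
        rw [← mul_sub, abs_mul, abs_of_pos hM'] at h3
        rw [hsub j hj p hp, le_div_iff₀' hM']
        exact h3.le
      refine h1.trans ?_
      rw [mul_one_div]
      gcongr
    -- `H = 2` since both functions have Hölder constant `1`; `d ≤ N` ensures `δ ≤ 1`.
    have hfin := norm_iteratedFDerivWithin_le_of_jet_le (h := g f - g f') (H := 2) (δ := d / N)
      hα.le zero_le_two
      ((hgcd f).sub (hgcd f')) (fun y hy z hz => by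
        rw [hsub k le_rfl y hy, hsub k le_rfl z hz, sub_sub_sub_comm]
        refine (norm_sub_le _ _).trans ?_
        linarith [hghol f hα y hy z hz, hghol f' hα y hy z hz])
      hp (by positivity) hjet (by positivity)
      ((div_le_one hN').2 (by exact_mod_cast hN)) k 0 (zero_add k) x hx hq
    rw [norm_iteratedFDerivWithin_zero] at hfin
    rw [Real.dist_eq, ← hg f ⟨x, hx⟩, ← hg f' ⟨x, hx⟩]
    exact hfin
  · have hcard : Fintype.card (Finset.Icc (-(M : ℤ)) M) = 2 * M + 1 := by
      rw [Fintype.card_coe, Int.card_Icc]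
      omega
    rw [Fintype.card_fun, Fintype.card_prod, Fintype.card_fun, Fintype.card_fin, Fintype.card_fin,
      hcard]

/-- The logarithm of the base is absorbed into a small power through `log u ≤ u ^ κ / κ`. -/
theorem pow_ceil_le_exp {d L : ℕ} {s κ y : ℝ} (hs : 0 < s) (hκ : 0 < κ) (hy : 1 ≤ y) :
    ((2 * (⌈y⌉₊ : ℝ) + 1) ^ ((⌈y ^ (1 / s)⌉₊ + 1) ^ d * L) : ℝ) ≤
      Real.exp (3 ^ d * L * (5 ^ κ / κ) * y ^ (d / s + κ)) := by
  have hy0 : 0 < y := by linarith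
  have hM : 2 * (⌈y⌉₊ : ℝ) + 1 ≤ 5 * y := by linarith [Nat.ceil_lt_add_one hy0.le]
  have hz : 1 ≤ y ^ (1 / s) := Real.one_le_rpow hy (by positivity)
  have hN : (⌈y ^ (1 / s)⌉₊ : ℝ) + 1 ≤ 3 * y ^ (1 / s) := by
    linarith [Nat.ceil_lt_add_one (zero_le_one.trans hz)]
  have hlog : Real.log (2 * (⌈y⌉₊ : ℝ) + 1) ≤ (5 * y) ^ κ / κ :=
    (Real.log_le_log (by positivity) hM).trans (Real.log_le_rpow_div (by positivity) hκ)
  rw [← Real.log_le_iff_le_exp (by positivity), Real.log_pow]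
  push_cast
  calc _ ≤ (3 * y ^ (1 / s)) ^ d * L * ((5 * y) ^ κ / κ) := by
        gcongr
        exact Real.log_nonneg (by linarith [Nat.cast_nonneg (α := ℝ) ⌈y⌉₊])
    _ = _ := by
      rw [mul_pow, ← Real.rpow_natCast (y ^ (1 / s)), ← Real.rpow_mul hy0.le,
        Real.mul_rpow (by norm_num) hy0.le, Real.rpow_add hy0,
        show 1 / s * d = d / s by ring]
      ring

theorem tendsto_mul_rpow_sub_mul_rpow {c c' γ β : ℝ} (hc' : 0 < c') (hβ : 0 < β) (h : γ < β) :
    Tendsto (fun y : ℝ => c * y ^ γ - c' * y ^ β) atTop atBot := by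
  have h1 : Tendsto (fun y : ℝ => c * y ^ (-(β - γ)) - c') atTop (𝓝 (c * 0 - c')) :=
    ((tendsto_rpow_neg_atTop (sub_pos.2 h)).const_mul c).sub tendsto_const_nhds
  refine ((tendsto_rpow_atTop hβ).atTop_mul_neg (by linarith) h1).congr' ?_
  filter_upwards [eventually_gt_atTop 0] with y hy
  have : y ^ γ = y ^ β * y ^ (-(β - γ)) := by
    rw [← Real.rpow_add hy]
    congr 1
    ring
  rw [this]
  ring

theorem tendsto_coveringNumber_subset_funSpace {d k : ℕ} (hd : 0 < d) {α β : ℝ} (hα : 0 < α)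
    (hβ : d < β * (k + α)) {S : Set C(cube d, ℝ)} (hS : S ⊆ funSpace d k α) :
    Tendsto (fun ε : ℝ => (coveringNumber S ε : ℝ≥0∞) * ENNReal.ofReal (ord β ε))
      (𝓝[>] 0) (𝓝 0) := by
  have hs : (0 : ℝ) < k + α := by positivity
  set s : ℝ := k + α with hsdef
  have hd0 : (0 : ℝ) < d := by exact_mod_cast hd
  have hβs : d / s < β := (div_lt_iff₀ hs).2 hβ
  have hβ0 : 0 < β := (div_pos hd0 hs).trans hβs
  -- Half of the available gap, so that `d / s + κ < β`.
  set κ : ℝ := (β - d / s) / 2 with hκdef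
  have hκ : 0 < κ := by linarith
  -- With `M = ⌈y⌉₊` and `N = ⌈y ^ (1 / s)⌉₊` the coding error is at most `B / y`; the radius `2 * B
  -- / y` makes the inequality strict.
  set B : ℝ := (k + 1) * (d : ℝ) ^ k + 2 * (d : ℝ) ^ s with hB
  have hB0 : 0 < B := by positivity
  set L := Fintype.card (Σ j : Fin (k + 1), Fin j → Fin d) with hL
  set c : ℝ := 3 ^ d * L * (5 ^ κ / κ) with hc
  have hcov : ∀ y : ℝ, 1 ≤ y → (d : ℝ) ≤ y ^ (1 / s) →
      (coveringNumber S (2 * B / y) : ℝ≥0∞) ≤ ENNReal.ofReal (Real.exp (c * y ^ (d / s + κ))) := by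
    intro y hy hdy
    have hy0 : 0 < y := by linarith
    have hyM : y ≤ ⌈y⌉₊ := Nat.le_ceil y
    have hyN : y ^ (1 / s) ≤ ⌈y ^ (1 / s)⌉₊ := Nat.le_ceil _
    have hN0 : (0 : ℝ) < ⌈y ^ (1 / s)⌉₊ := (Real.rpow_pos_of_pos hy0 _).trans_le hyN
    have hyNs : y ≤ (⌈y ^ (1 / s)⌉₊ : ℝ) ^ s := by
      have := Real.rpow_le_rpow (by positivity) hyN hs.le
      rwa [← Real.rpow_mul hy0.le, one_div_mul_cancel hs.ne', Real.rpow_one] at this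
    have hcn := coveringNumber_subset_funSpace_le hd hα hS (M := ⌈y⌉₊) (N := ⌈y ^ (1 / s)⌉₊)
      (ε := 2 * B / y) (Nat.ceil_pos.2 hy0) (by exact_mod_cast hdy.trans hyN) (by
        have h1 : ((d : ℝ) / ⌈y ^ (1 / s)⌉₊) ^ s ≤ (d : ℝ) ^ s / y := by
          rw [Real.div_rpow hd0.le hN0.le]
          gcongr
        have h2 : (d : ℝ) ^ k / ⌈y⌉₊ ≤ (d : ℝ) ^ k / y := by gcongr
        calc _ ≤ (k + 1) * ((d : ℝ) ^ k / y) + 2 * ((d : ℝ) ^ s / y) := by gcongr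
          _ = B / y := by rw [hB]; ring
          _ < 2 * B / y := by gcongr; linarith)
    calc (coveringNumber S (2 * B / y) : ℝ≥0∞) ≤ _ := ENat.toENNReal_le.2 hcn
      _ = ENNReal.ofReal
          ((2 * (⌈y⌉₊ : ℝ) + 1) ^ ((⌈y ^ (1 / s)⌉₊ + 1) ^ d * L) : ℝ) := by
          rw [ENat.toENNReal_coe, ← ENNReal.ofReal_natCast]
          push_cast
          rfl
      _ ≤ _ := ENNReal.ofReal_le_ofReal (pow_ceil_le_exp hs hκ hy)
  have hy : Tendsto (fun ε : ℝ => 2 * B / ε) (𝓝[>] 0) atTop :=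
    tendsto_inv_nhdsGT_zero.const_mul_atTop (by positivity)
  have hlim : Tendsto (fun ε : ℝ => ENNReal.ofReal (Real.exp (c * (2 * B / ε) ^ (d / s + κ) -
      (2 * B) ^ (-β) * (2 * B / ε) ^ β))) (𝓝[>] 0) (𝓝 0) := by
    rw [← ENNReal.ofReal_zero]
    exact ENNReal.tendsto_ofReal (Real.tendsto_exp_atBot.comp
      ((tendsto_mul_rpow_sub_mul_rpow (by positivity) hβ0 (by linarith)).comp hy))
  refine tendsto_of_tendsto_of_tendsto_of_le_of_le' tendsto_const_nhds hlim
    (Eventually.of_forall fun _ => zero_le) ?_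
  filter_upwards [self_mem_nhdsWithin, hy.eventually_ge_atTop 1,
    ((tendsto_rpow_atTop (by positivity : 0 < 1 / s)).comp hy).eventually_ge_atTop (d : ℝ)]
    with ε hε h1 h2
  have hε0 : (0 : ℝ) < ε := hε
  have h3 := hcov (2 * B / ε) h1 h2
  rw [div_div_cancel₀ (by positivity)] at h3
  have h4 : (2 * B) ^ (-β) * (2 * B / ε) ^ β = ε ^ (-β) := by
    rw [Real.div_rpow (by positivity) hε0.le, Real.rpow_neg (by positivity),
      Real.rpow_neg hε0.le]
    have : (2 * B) ^ β ≠ 0 := by positivity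
    field_simp
  rw [h4, sub_eq_add_neg, Real.exp_add, ENNReal.ofReal_mul (Real.exp_pos _).le]
  exact mul_le_mul_left h3 _

theorem upperBoxScale_subset_funSpace_le {d k : ℕ} (hd : 0 < d) {α : ℝ} (hα : 0 < α)
    {S : Set C(cube d, ℝ)} (hS : S ⊆ funSpace d k α) :
    upperBoxScale ord S ≤ (d : ℝ≥0∞) / ((k : ℝ≥0∞) + ENNReal.ofReal α) := by
  by_contra! hlt
  obtain ⟨β, hβ1, hβ2⟩ := ENNReal.lt_iff_exists_nnreal_btwn.1 hlt
  have hpos : (0 : ℝ) < k + α := by positivity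
  have h1 : (d : ℝ) < β * (k + α) := by
    have h2 : ENNReal.ofReal d < ENNReal.ofReal (β * (k + α)) := by
      rw [ENNReal.ofReal_mul β.coe_nonneg, ENNReal.ofReal_add (by positivity) hα.le,
        ENNReal.ofReal_natCast, ENNReal.ofReal_natCast, ENNReal.ofReal_coe_nnreal]
      exact (ENNReal.div_lt_iff (Or.inl (by simp [hα]))
        (Or.inl (ENNReal.add_ne_top.2 ⟨ENNReal.natCast_ne_top k, ENNReal.ofReal_ne_top⟩))).1 hβ1
    exact (ENNReal.ofReal_lt_ofReal_iff_of_nonneg (by positivity)).1 h2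
  have hβ0 : (0 : ℝ) < β := pos_of_mul_pos_left ((Nat.cast_nonneg d).trans_lt h1) hpos.le
  refine absurd hβ2 (not_lt.2 ?_)
  rw [← ENNReal.ofReal_coe_nnreal]
  exact iInf₂_le (β : ℝ) ⟨hβ0, tendsto_coveringNumber_subset_funSpace hd hα h1 hS⟩

/-- For `α = 0` no Hölder condition is available, but a bounded derivative of order `k + 1` makes
the `k`-th one Lipschitz on the convex cube, and `k + α` keeps its value. -/
theorem funSpace_succ_zero_subset (d k : ℕ) : funSpace d (k + 1) 0 ⊆ funSpace d k 1 := by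
  rintro f ⟨g, hg, hcd, hle, -⟩
  refine ⟨g, hg, hcd.of_le (by exact_mod_cast k.le_succ), fun j hj => hle j (by omega),
    fun _ x hx y hy => ?_⟩
  have hdiff : DifferentiableOn ℝ (iteratedFDerivWithin ℝ k g (cube d)) (cube d) :=
    hcd.differentiableOn_iteratedFDerivWithin (by exact_mod_cast k.lt_succ_self)
      (uniqueDiffOn_cube d)
  have := (convex_cube d).norm_image_sub_le_of_norm_fderivWithin_le hdiff (C := 1)
    (fun z hz => by
      rw [norm_fderivWithin_iteratedFDerivWithin]
      exact hle (k + 1) le_rfl z hz) hy hx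
  rwa [Real.rpow_one, ← one_mul ‖x - y‖]

theorem upperBoxScale_funSpace_le {d : ℕ} (hd : 0 < d) (k : ℕ) {α : ℝ} (hα : 0 ≤ α) :
    upperBoxScale ord (funSpace d k α) ≤ (d : ℝ≥0∞) / ((k : ℝ≥0∞) + ENNReal.ofReal α) := by
  rcases hα.lt_or_eq with hα | rfl
  · exact upperBoxScale_subset_funSpace_le hd hα Subset.rfl
  rcases k with _ | k
  · have hd0 : (d : ℝ≥0∞) ≠ 0 := by exact_mod_cast hd.ne'
    rw [Nat.cast_zero, ENNReal.ofReal_zero, add_zero, ENNReal.div_zero hd0]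
    exact le_top
  · have := upperBoxScale_subset_funSpace_le hd one_pos (funSpace_succ_zero_subset d k)
    simpa using this

end MetricScale

end

theorem mainTheorem7 (d : ℕ) (hd : 0 < d) (k : ℕ) (α : ℝ) (hα : α ∈ Set.Icc (0 : ℝ) 1) :
    MetricScale.hausdorffScale MetricScale.ord (MetricScale.funSpace d k α) =
        (d : ℝ≥0∞) / ((k : ℝ≥0∞) + ENNReal.ofReal α) ∧
    MetricScale.packingScale MetricScale.ord (MetricScale.funSpace d k α) =
        (d : ℝ≥0∞) / ((k : ℝ≥0∞) + ENNReal.ofReal α) ∧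
    MetricScale.lowerBoxScale MetricScale.ord (MetricScale.funSpace d k α) =
        (d : ℝ≥0∞) / ((k : ℝ≥0∞) + ENNReal.ofReal α) ∧
    MetricScale.upperBoxScale MetricScale.ord (MetricScale.funSpace d k α) =
        (d : ℝ≥0∞) / ((k : ℝ≥0∞) + ENNReal.ofReal α) := by
  have hH := MetricScale.le_hausdorffScale_funSpace (k := k) hd hα
  have hU := MetricScale.upperBoxScale_funSpace_le hd k hα.1
  have hHP := MetricScale.hausdorffScale_le_packingScale (MetricScale.funSpace d k α)
  have hPU := MetricScale.packingScale_le_upperBoxScale (MetricScale.funSpace d k α)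
  have hHL := MetricScale.hausdorffScale_le_lowerBoxScale (MetricScale.funSpace d k α)
  have hLU := MetricScale.lowerBoxScale_le_upperBoxScale (MetricScale.funSpace d k α)
  exact ⟨le_antisymm ((hHP.trans hPU).trans hU) hH, le_antisymm (hPU.trans hU) (hH.trans hHP),
    le_antisymm (hLU.trans hU) (hH.trans hHL), le_antisymm hU (hH.trans (hHL.trans hLU))⟩
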